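/- For an integer $n\ge 63$ write $$E(n)=\Bigl(\tfrac{4\cdot 11^{6}}{7^{7}}\,n\,(n-1)^{6}(n-3)^{n-7}\Bigr)^{1/2};$$ for $n\equiv 3 \pmod 4$ this is the Ehlich bound on the determinant of an $n\times n$ matrix with entries in $\{\pm1\}$. Let $J$ denote the all-ones matrix and $j$ the all-ones row vector of length $k$. **Theorem.** (1) Let $n=2k+1\ge 63$, let $r,s$ be real numbers with $r\le 0$, and let $R,S$ be real $k\times k$ matrices satisfying $$RJ=JR=rJ,\qquad SJ=JS=sJ,\qquad RR^{\top}+SS^{\top}=(2k-2)I+2J$$ (so that $r^{2}+s^{2}=4k-2$). Let $$M_{1}=\begin{pmatrix} R & S & j^{\top}\\ S & -R & -j^{\top}\\ j & j & 1\end{pmatrix},\qquad M_{2}=\begin{pmatrix} R & S & j^{\top}\\ S^{\top} & -R^{\top} & -j^{\top}\\ j & j & 1\end{pmatrix}.$$ If $RS^{\top}=SR^{\top}$, then $|\det M_{1}|\ge \dfrac{|r|}{3\sqrt{n}}\,E(n)$. If $RS=SR$ (for instance, if $R$ and $S$ are circulant), then $|\det M_{2}|\ge \dfrac{|r|}{3\sqrt{n}}\,E(n)$.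 (The condition $r\le 0$ can always be achieved by replacing $R,S$ by $-R,-S$.) (2) Let $q$ be an odd prime power and $n=4q^{2}+4q+3$. If $q\ge 379$, there is an $n\times n$ matrix with entries in $\{\pm1\}$ whose determinant exceeds $0.34\,E(n)$. If $q\ge 47$, there is one whose determinant exceeds $\tfrac13E(n)$. (3) Let $q$ be a prime power and $n=2q^{2}+2q+3$. If $q\ge 233$, there is an $n\times n$ matrix with entries in $\{\pm1\}$ whose determinant exceeds $0.48\,E(n)$. If $q\ge 43$, there is one whose determinant exceeds $0.47\,E(n)$. -/

import Mathlib

open Matrix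

noncomputable section

/-- The all-ones square matrix `J`. -/
def allOnes (k : ℕ) : Matrix (Fin k) (Fin k) ℝ := Matrix.of fun _ _ => 1

/-- The hypotheses on the pair of `k × k` real matrices from which the bordered matrices are built:
`RJ = JR = rJ`, `SJ = JS = sJ` and `RRᵀ + SSᵀ = (2k-2)I + 2J`.
(For `k ≥ 1` these force `r² + s² = 4k - 2`.) -/
structure IsBorderPair {k : ℕ} (R S : Matrix (Fin k) (Fin k) ℝ) (r s : ℝ) : Prop where
  mul_ones_left : R * allOnes k = r • allOnes k
  ones_mul_left : allOnes k * R = r • allOnes k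
  mul_ones_right : S * allOnes k = s • allOnes k
  ones_mul_right : allOnes k * S = s • allOnes k
  gram : R * Rᵀ + S * Sᵀ = (2 * (k : ℝ) - 2) • (1 : Matrix (Fin k) (Fin k) ℝ) + (2 : ℝ) • allOnes k

/-- The bordering of a `2k × 2k` matrix to order `2k + 1`: the last column is
`(1, …, 1, -1, …, -1, 1)ᵀ` and the last row is all ones. -/
def border {k : ℕ} (N : Matrix (Fin k ⊕ Fin k) (Fin k ⊕ Fin k) ℝ) :
    Matrix ((Fin k ⊕ Fin k) ⊕ Unit) ((Fin k ⊕ Fin k) ⊕ Unit) ℝ :=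
  Matrix.fromBlocks N
    (Matrix.of fun i _ => Sum.elim (fun _ => (1 : ℝ)) (fun _ => (-1 : ℝ)) i)
    (Matrix.of fun _ _ => 1)
    (Matrix.of fun _ _ => 1)

/-- The matrix with block rows `(R, S, jᵀ)`, `(S, -R, -jᵀ)`, `(j, j, 1)`. -/
def borderedM₁ {k : ℕ} (R S : Matrix (Fin k) (Fin k) ℝ) :
    Matrix ((Fin k ⊕ Fin k) ⊕ Unit) ((Fin k ⊕ Fin k) ⊕ Unit) ℝ :=
  border (Matrix.fromBlocks R S S (-R))

/-- The matrix with block rows `(R, S, jᵀ)`, `(Sᵀ, -Rᵀ, -jᵀ)`, `(j, j, 1)`. -/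
def borderedM₂ {k : ℕ} (R S : Matrix (Fin k) (Fin k) ℝ) :
    Matrix ((Fin k ⊕ Fin k) ⊕ Unit) ((Fin k ⊕ Fin k) ⊕ Unit) ℝ :=
  border (Matrix.fromBlocks R S Sᵀ (-Rᵀ))

/-- The Ehlich bound on the determinant of a `±1` matrix of order `n ≡ 3 mod 4`, `n ≥ 63`:
the square root of the bound `(4 · 11⁶ / 7⁷) n (n-1)⁶ (n-3)ⁿ⁻⁷` on the Gram determinant. -/
def ehlichBound (n : ℕ) : ℝ :=
  √(4 * 11 ^ 6 / 7 ^ 7 * (n : ℝ) * ((n : ℝ) - 1) ^ 6 * ((n : ℝ) - 3) ^ (n - 7))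

/-- There is a `±1` matrix of order `n` whose determinant exceeds the fraction `c`
of the Ehlich bound. -/
def ExistsExceedingEhlich (n : ℕ) (c : ℝ) : Prop :=
  ∃ M : Matrix (Fin n) (Fin n) ℝ,
    (∀ i j, M i j = 1 ∨ M i j = -1) ∧ c * ehlichBound n < M.det

end

/-! Part (1) is an exact evaluation. Let `N` be the unbordered `2k × 2k` matrix. Its Gram matrix is
block diagonal, which gives `|det N| = det (RRᵀ + SSᵀ) = (2k-2)^(k-1) (4k-2)`; for `M₂` the second
block is `RᵀR + SᵀS`, handled by `det_gram_eq_of_commute`. Constant row sums allow `N v = (1, -1)`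
to be solved with `v` constant on each half, so the border multiplies the determinant by `1 + 2k|r|
/ (4k-2)`. Hence `|det M| = (2k-2)^(k-1) (4k-2 + 2k|r|)` (`abs_det_border`), and what remains is a
real inequality.

Parts (2) and (3) supply commuting sign pairs with `r = -(2q+1)`, which is about `-√n` in (2) and
`-√(2n)` in (3). As `√(4·11⁶/7⁷) ≈ 2.933`, the limiting fractions of the bound are about `0.3409`
and `0.4821`.

For (2), `R = S = -B`, where `B` is the sign matrix of Brouwer's symmetric design on `2q²+2q+1`
points. It is glued from an affine plane, a Paley conference matrix and the two parts of a Hadamard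
design (`brouwerMatrix_gram`).

For (3), a Singer difference set in a group of order `q²+q+1` gives `A` with `AAᵀ = qI + J`. The
matrix `X = A² - J` has entries `0, ±1` and satisfies `XXᵀ = q²I`. Its zeros are exactly the ones of
the matrix `C` of the squared difference set, so `-(C+X)` and `-(C-X)` form the required pair
(`IsSidonFamily.exists_isBorderPairOn`). -/

/-- The hypotheses of `IsBorderPair` for matrices over an arbitrary finite index type, with
the commutation conditions with `J` expressed by row and column sums. -/
structure IsBorderPairOn {ι : Type*} [Fintype ι] [DecidableEq ι] (R S : Matrix ι ι ℝ)
    (r s : ℝ) : Prop where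
  row_left : ∀ i, ∑ j, R i j = r
  col_left : ∀ j, ∑ i, R i j = r
  row_right : ∀ i, ∑ j, S i j = s
  col_right : ∀ j, ∑ i, S i j = s
  gram : R * Rᵀ + S * Sᵀ = (2 * (Fintype.card ι : ℝ) - 2) • (1 : Matrix ι ι ℝ)
    + (2 : ℝ) • Matrix.of fun _ _ => 1

theorem IsBorderPair.isBorderPairOn {k : ℕ} {R S : Matrix (Fin k) (Fin k) ℝ} {r s : ℝ}
    (h : IsBorderPair R S r s) : IsBorderPairOn R S r s where
  row_left i := by simpa [Matrix.mul_apply, allOnes] using congrFun₂ h.mul_ones_left i i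
  col_left i := by simpa [Matrix.mul_apply, allOnes] using congrFun₂ h.ones_mul_left i i
  row_right i := by simpa [Matrix.mul_apply, allOnes] using congrFun₂ h.mul_ones_right i i
  col_right i := by simpa [Matrix.mul_apply, allOnes] using congrFun₂ h.ones_mul_right i i
  gram := by simpa [allOnes] using h.gram

/-! ### Determinants of bordered block matrices. -/

/-- The determinant of `a I + b J`. -/
theorem det_smul_one_add_smul_ones {ι : Type*} [Fintype ι] [DecidableEq ι] [Nonempty ι]
    {a : ℝ} (ha : a ≠ 0) (b : ℝ) :
    (a • (1 : Matrix ι ι ℝ) + b • Matrix.of fun _ _ => 1).det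
      = a ^ (Fintype.card ι - 1) * (a + Fintype.card ι * b) := by
  have h : (a • (1 : Matrix ι ι ℝ) + b • Matrix.of fun _ _ => 1)
      = a • (1 + replicateCol Unit (fun _ : ι => b / a) * replicateRow Unit (fun _ : ι => (1 : ℝ))) := by
    ext i j
    simp [Matrix.mul_apply, Matrix.one_apply, mul_add]
    field_simp
  rw [h, det_smul, det_one_add_replicateCol_mul_replicateRow]
  obtain ⟨m, hm⟩ : ∃ m, Fintype.card ι = m + 1 := ⟨_, (Nat.succ_pred_eq_of_pos Fintype.card_pos).symm⟩
  simp [dotProduct, hm, pow_succ]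
  field_simp

/-- Bordering a matrix `N` by a column `N v` in its column space. -/
theorem det_fromBlocks_mulVec {m : Type*} [Fintype m] [DecidableEq m] (N : Matrix m m ℝ)
    (v c w : m → ℝ) (hv : N *ᵥ v = c) (d : ℝ) :
    (fromBlocks N (Matrix.of fun i (_ : Unit) => c i) (Matrix.of fun (_ : Unit) i => w i)
      (Matrix.of fun _ _ => d)).det = N.det * (d - w ⬝ᵥ v) := by
  have h : fromBlocks N (Matrix.of fun i (_ : Unit) => c i) (Matrix.of fun (_ : Unit) i => w i)
      (Matrix.of fun _ _ => d)
      = fromBlocks N 0 (Matrix.of fun (_ : Unit) i => w i) (Matrix.of fun _ _ => d - w ⬝ᵥ v)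
        * fromBlocks 1 (Matrix.of fun i (_ : Unit) => v i) 0 1 := by
    subst hv
    rw [fromBlocks_multiply]
    congr 1
    · simp
    · ext i j; simp [Matrix.mul_apply, mulVec, dotProduct]
    · simp
    · ext i j; simp [Matrix.mul_apply, dotProduct]
  rw [h, det_mul, det_fromBlocks_zero₁₂, det_fromBlocks_zero₂₁]
  simp

/-- For commuting `R`, `S`, the matrices `R Rᵀ + S Sᵀ` and `Rᵀ R + Sᵀ S` have the same
determinant, if `R` is invertible. -/
theorem det_gram_eq_of_isUnit {ι : Type*} [Fintype ι] [DecidableEq ι] (R S : Matrix ι ι ℝ)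
    (h : R * S = S * R) (hR : IsUnit R.det) :
    (R * Rᵀ + S * Sᵀ).det = (Rᵀ * R + Sᵀ * S).det := by
  have h1 : R * (R⁻¹ * S) = S := by rw [← Matrix.mul_assoc, mul_nonsing_inv _ hR, Matrix.one_mul]
  have h2 : (R⁻¹ * S) * R = S := by
    rw [Matrix.mul_assoc, ← h, ← Matrix.mul_assoc, nonsing_inv_mul _ hR, Matrix.one_mul]
  generalize R⁻¹ * S = X at h1 h2
  have e1 : R * Rᵀ + S * Sᵀ = R * (1 + X * Xᵀ) * Rᵀ := by
    rw [← h1, transpose_mul]; simp only [Matrix.mul_add, Matrix.add_mul, Matrix.mul_one, Matrix.mul_assoc]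
  have e2 : Rᵀ * R + Sᵀ * S = Rᵀ * (1 + Xᵀ * X) * R := by
    rw [← h2, transpose_mul]; simp only [Matrix.mul_add, Matrix.add_mul, Matrix.mul_one, Matrix.mul_assoc]
  rw [e1, e2, det_mul, det_mul, det_mul, det_mul, det_one_add_mul_comm]
  ring

/-- Perturbation removes the invertibility assumption: `R + t I` still commutes with `S` and is
singular for only finitely many `t`, and both sides are continuous in `t`. Neither matrix need be
normal. -/
theorem det_gram_eq_of_commute {ι : Type*} [Fintype ι] [DecidableEq ι] (R S : Matrix ι ι ℝ)
    (h : R * S = S * R) : (R * Rᵀ + S * Sᵀ).det = (Rᵀ * R + Sᵀ * S).det := by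
  let P : ℝ → Matrix ι ι ℝ := fun t => R + t • 1
  have hP : Continuous P := by fun_prop
  have hfin : {t : ℝ | (P t).det = 0}.Finite := by
    have hne : (-R).charpoly ≠ 0 := (Matrix.charpoly_monic _).ne_zero
    refine ((-R).charpoly.roots.toFinset.finite_toSet).subset fun t ht => ?_
    simp only [Finset.mem_coe, Multiset.mem_toFinset, Polynomial.mem_roots hne, Polynomial.IsRoot]
    rw [Matrix.eval_charpoly]
    have : (scalar ι t - -R : Matrix ι ι ℝ) = P t := by
      ext i j; simp [P, Matrix.one_apply, Matrix.diagonal_apply, add_comm]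
    rw [this]; exact ht
  have hdense : Dense {t : ℝ | (P t).det = 0}ᶜ := hfin.countable.dense_compl ℝ
  have key : (fun t => (P t * (P t)ᵀ + S * Sᵀ).det) = fun t => ((P t)ᵀ * P t + Sᵀ * S).det := by
    refine Continuous.ext_on hdense (by fun_prop) (by fun_prop) fun t ht => ?_
    refine det_gram_eq_of_isUnit _ _ ?_ (isUnit_iff_ne_zero.2 ht)
    simp [P, Matrix.add_mul, Matrix.mul_add, h]
  simpa [P] using congrFun key 0

namespace IsBorderPairOn

variable {ι : Type*} [Fintype ι] [DecidableEq ι] {R S : Matrix ι ι ℝ} {r s : ℝ}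

theorem sq_add_sq [Nonempty ι] (h : IsBorderPairOn R S r s) :
    r ^ 2 + s ^ 2 = 4 * Fintype.card ι - 2 := by
  obtain ⟨i⟩ := ‹Nonempty ι›
  have key : ∀ (A : Matrix ι ι ℝ) (a : ℝ), (∀ i, ∑ j, A i j = a) → (∀ j, ∑ i, A i j = a) →
      ∑ j, (A * Aᵀ) i j = a ^ 2 := by
    intro A a h1 h2
    simp only [Matrix.mul_apply, transpose_apply]
    rw [Finset.sum_comm]
    simp only [← Finset.mul_sum, h2]
    rw [← Finset.sum_mul, h1, sq]
  rw [← key R r h.row_left h.col_left, ← key S s h.row_right h.col_right, ← Finset.sum_add_distrib]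
  simp only [← Matrix.add_apply, h.gram]
  simp [Finset.sum_add_distrib, Matrix.one_apply]
  ring

theorem det_gram (h : IsBorderPairOn R S r s) (hk : 2 ≤ Fintype.card ι) :
    (R * Rᵀ + S * Sᵀ).det = (2 * (Fintype.card ι : ℝ) - 2) ^ (Fintype.card ι - 1)
      * (4 * Fintype.card ι - 2) := by
  have : Nonempty ι := Fintype.card_pos_iff.1 (by omega)
  have h2 : (2 : ℝ) ≤ Fintype.card ι := by exact_mod_cast hk
  rw [h.gram, det_smul_one_add_smul_ones (by linarith)]
  ring

/-- Common to both borderings, with `(T, U) = (S, R)` or `(Sᵀ, Rᵀ)`. The sign of `r` matters: it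
makes the border factor `1 - 2kr/(4k-2)` exceed `1` whenever `r ≠ 0`. -/
theorem abs_det_border (h : IsBorderPairOn R S r s) (hk : 2 ≤ Fintype.card ι) (hr : r ≤ 0)
    {T U : Matrix ι ι ℝ} (hT : ∀ i, ∑ j, T i j = s) (hU : ∀ i, ∑ j, U i j = r)
    (hdet : (fromBlocks R S T (-U)).det ^ 2 = (R * Rᵀ + S * Sᵀ).det ^ 2) :
    |(fromBlocks (fromBlocks R S T (-U))
      (Matrix.of fun i (_ : Unit) => Sum.elim (fun _ => (1 : ℝ)) (fun _ => (-1 : ℝ)) i)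
      (Matrix.of fun _ _ => 1) (Matrix.of fun _ _ => 1)).det|
      = (2 * (Fintype.card ι : ℝ) - 2) ^ (Fintype.card ι - 1)
        * (4 * Fintype.card ι - 2 + 2 * Fintype.card ι * |r|) := by
  have : Nonempty ι := Fintype.card_pos_iff.1 (by omega)
  have h2 : (2 : ℝ) ≤ Fintype.card ι := by exact_mod_cast hk
  have hrs := h.sq_add_sq
  set K : ℝ := (Fintype.card ι : ℝ) with hK
  have hpos : (0 : ℝ) < 4 * K - 2 := by linarith
  have hrs0 : r ^ 2 + s ^ 2 ≠ 0 := by rw [hrs]; exact hpos.ne'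
  -- The two values solve `r a + s b = 1`, `s a - r b = -1`.
  have hmul : fromBlocks R S T (-U) *ᵥ
      (Sum.elim (fun _ => (r - s) / (r ^ 2 + s ^ 2)) (fun _ => (r + s) / (r ^ 2 + s ^ 2)))
      = Sum.elim (fun _ => (1 : ℝ)) (fun _ => (-1 : ℝ)) := by
    ext i
    rcases i with i | i
    · simp only [mulVec, dotProduct, Fintype.sum_sum_type, Sum.elim_inl, Sum.elim_inr,
        fromBlocks_apply₁₁, fromBlocks_apply₁₂, ← Finset.sum_mul, h.row_left, h.row_right]
      field_simp; ring
    · simp only [mulVec, dotProduct, Fintype.sum_sum_type, Sum.elim_inl, Sum.elim_inr,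
        fromBlocks_apply₂₁, fromBlocks_apply₂₂, ← Finset.sum_mul, hT, Matrix.neg_apply,
        Finset.sum_neg_distrib, hU]
      field_simp; ring
  have hone : (Matrix.of fun (_ : Unit) (_ : ι ⊕ ι) => (1 : ℝ))
    = Matrix.of fun _ i => (fun _ => (1 : ℝ)) i := rfl
  rw [hone, det_fromBlocks_mulVec _ _ _ _ hmul, abs_mul]
  have e1 : |(fromBlocks R S T (-U)).det| = (2 * K - 2) ^ (Fintype.card ι - 1) * (4 * K - 2) := by
    rw [sq_eq_sq_iff_abs_eq_abs, h.det_gram hk] at hdet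
    rw [hdet, ← hK]
    exact abs_of_nonneg (mul_nonneg (pow_nonneg (by linarith) _) hpos.le)
  have e2 : (1 : ℝ) - (fun _ => (1 : ℝ)) ⬝ᵥ
      (Sum.elim (fun _ : ι => (r - s) / (r ^ 2 + s ^ 2)) (fun _ : ι => (r + s) / (r ^ 2 + s ^ 2)))
      = 1 + 2 * K * |r| / (4 * K - 2) := by
    rw [abs_of_nonpos hr]
    simp [dotProduct, Fintype.sum_sum_type, ← hK, hrs]
    field_simp; ring
  rw [e1, e2, abs_of_nonneg (by positivity), mul_assoc]
  congr 1
  field_simp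

theorem abs_det_border₁ (h : IsBorderPairOn R S r s) (hk : 2 ≤ Fintype.card ι) (hr : r ≤ 0)
    (hc : R * Sᵀ = S * Rᵀ) :
    |(fromBlocks (fromBlocks R S S (-R))
      (Matrix.of fun i (_ : Unit) => Sum.elim (fun _ => (1 : ℝ)) (fun _ => (-1 : ℝ)) i)
      (Matrix.of fun _ _ => 1) (Matrix.of fun _ _ => 1)).det|
      = (2 * (Fintype.card ι : ℝ) - 2) ^ (Fintype.card ι - 1)
        * (4 * Fintype.card ι - 2 + 2 * Fintype.card ι * |r|) := by
  refine h.abs_det_border hk hr h.row_right h.row_left ?_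
  calc (fromBlocks R S S (-R)).det ^ 2
      = (fromBlocks R S S (-R) * (fromBlocks R S S (-R))ᵀ).det := by
        rw [det_mul, det_transpose, sq]
    _ = (fromBlocks (R * Rᵀ + S * Sᵀ) 0 0 (R * Rᵀ + S * Sᵀ)).det := by
        rw [fromBlocks_transpose, fromBlocks_multiply]
        congr 2
        · simp [hc]
        · simp [hc]
        · simp [add_comm]
    _ = _ := by rw [det_fromBlocks_zero₂₁, sq]

theorem abs_det_border₂ (h : IsBorderPairOn R S r s) (hk : 2 ≤ Fintype.card ι) (hr : r ≤ 0)
    (hc : R * S = S * R) :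
    |(fromBlocks (fromBlocks R S Sᵀ (-Rᵀ))
      (Matrix.of fun i (_ : Unit) => Sum.elim (fun _ => (1 : ℝ)) (fun _ => (-1 : ℝ)) i)
      (Matrix.of fun _ _ => 1) (Matrix.of fun _ _ => 1)).det|
      = (2 * (Fintype.card ι : ℝ) - 2) ^ (Fintype.card ι - 1)
        * (4 * Fintype.card ι - 2 + 2 * Fintype.card ι * |r|) := by
  have hc' : Sᵀ * Rᵀ = Rᵀ * Sᵀ := by rw [← transpose_mul, ← transpose_mul, hc]
  refine h.abs_det_border hk hr h.col_right h.col_left ?_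
  calc (fromBlocks R S Sᵀ (-Rᵀ)).det ^ 2
      = (fromBlocks R S Sᵀ (-Rᵀ) * (fromBlocks R S Sᵀ (-Rᵀ))ᵀ).det := by
        rw [det_mul, det_transpose, sq]
    _ = (fromBlocks (R * Rᵀ + S * Sᵀ) 0 0 (Rᵀ * R + Sᵀ * S)).det := by
        rw [fromBlocks_transpose, fromBlocks_multiply]
        congr 2
        · simp [hc]
        · simp [hc']
        · simp [add_comm]
    _ = _ := by rw [det_fromBlocks_zero₂₁, ← det_gram_eq_of_commute R S hc, sq]

end IsBorderPairOn

/-! ### Comparison with the Ehlich bound. -/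

theorem ehlichBound_eq {k : ℕ} (hk : 3 ≤ k) :
    ehlichBound (2 * k + 1) = √(4 * 11 ^ 6 / 7 ^ 7 * (2 * (k : ℝ) + 1)) * (2 * (k : ℝ)) ^ 3
      * (2 * (k : ℝ) - 2) ^ (k - 3) := by
  have h3 : (3 : ℝ) ≤ k := by exact_mod_cast hk
  have he : 2 * k + 1 - 7 = (k - 3) * 2 := by omega
  rw [ehlichBound, he]
  have : (4 * 11 ^ 6 / 7 ^ 7 * ((2 * k + 1 : ℕ) : ℝ) * (((2 * k + 1 : ℕ) : ℝ) - 1) ^ 6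
      * (((2 * k + 1 : ℕ) : ℝ) - 3) ^ ((k - 3) * 2))
      = (4 * 11 ^ 6 / 7 ^ 7 * (2 * (k : ℝ) + 1))
        * ((2 * (k : ℝ)) ^ 3 * (2 * (k : ℝ) - 2) ^ (k - 3)) ^ 2 := by
    push_cast
    rw [pow_mul, mul_pow, ← pow_mul (2 * (k : ℝ)), show (2 * (k : ℝ) + 1 - 3) = 2 * k - 2 by ring,
      add_sub_cancel_right]
    ring
  rw [this, Real.sqrt_mul (by positivity), Real.sqrt_sq, mul_assoc]
  exact mul_nonneg (by positivity) (pow_nonneg (by linarith) _)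

theorem pow_pred_mul_eq {k : ℕ} (hk : 3 ≤ k) (W : ℝ) :
    (2 * (k : ℝ) - 2) ^ (k - 1) * W
      = (2 * (k : ℝ) - 2) ^ 2 * W * (2 * (k : ℝ) - 2) ^ (k - 3) := by
  obtain ⟨m, rfl⟩ := Nat.exists_eq_add_of_le hk
  have h1 : 3 + m - 1 = m + 2 := by omega
  have h2 : 3 + m - 3 = m := by omega
  rw [h1, h2]
  ring

/-- After cancelling `(2k-2)^(k-3)` the constant `√(4·11⁶/7⁷)/3 ≈ 0.9778` must be absorbed by `(1 -
1/k)²`, with help from the summand `4k-2` when `k` is small. -/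
theorem mul_ehlichBound_le {k : ℕ} (hk : 31 ≤ k) {r s : ℝ} (hrs : r ^ 2 + s ^ 2 = 4 * k - 2) :
    |r| / (3 * √((2 * k + 1 : ℕ) : ℝ)) * ehlichBound (2 * k + 1)
      ≤ (2 * (k : ℝ) - 2) ^ (k - 1) * (4 * k - 2 + 2 * k * |r|) := by
  have h31 : (31 : ℝ) ≤ k := by exact_mod_cast hk
  have hA : √(4 * 11 ^ 6 / 7 ^ 7 : ℝ) ≤ 3 * 0.978 := by
    rw [Real.sqrt_le_left (by norm_num)]; norm_num
  have hn : (0 : ℝ) < √(2 * (k : ℝ) + 1) := Real.sqrt_pos.2 (by linarith)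
  rw [ehlichBound_eq (by omega), pow_pred_mul_eq (by omega), ← mul_assoc]
  refine mul_le_mul_of_nonneg_right ?_ (pow_nonneg (by linarith) _)
  have e : |r| / (3 * √((2 * k + 1 : ℕ) : ℝ)) * (√(4 * 11 ^ 6 / 7 ^ 7 * (2 * (k : ℝ) + 1))
      * (2 * (k : ℝ)) ^ 3) = |r| * (2 * (k : ℝ)) ^ 3 / 3 * √(4 * 11 ^ 6 / 7 ^ 7 : ℝ) := by
    rw [Real.sqrt_mul (by positivity)]
    push_cast
    field_simp
  rw [e]
  have hr0 := abs_nonneg r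
  have hr2 : |r| ^ 2 ≤ 4 * k - 2 := by rw [sq_abs]; nlinarith [sq_nonneg s]
  generalize |r| = x at hr0 hr2
  refine (mul_le_mul_of_nonneg_left hA (by positivity)).trans ?_
  generalize (k : ℝ) = t at h31 hr2
  have h0 : 0 ≤ 2 * t * x := by positivity
  have h1 : 0 ≤ (2 * t - 2) ^ 2 := sq_nonneg _
  -- For `t ≥ 95` already `(1 - 1/t)² ≥ 0.978`. Below that, `|r| ≤ 20` makes `4t-2` worth at least
  -- five percent of `2t|r|`, and `1.05 (1 - 1/t)² ≥ 0.978` holds from `t = 31`.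
  rcases le_total 95 t with h95 | h95
  · have h2 : 0.978 * (2 * t) ^ 2 ≤ (2 * t - 2) ^ 2 := by nlinarith
    have h3 : 0 ≤ (2 * t - 2) ^ 2 * (4 * t - 2) := mul_nonneg h1 (by linarith)
    nlinarith [mul_le_mul_of_nonneg_left h2 h0]
  · have hx : x ≤ 20 := by nlinarith
    have h2 : 0.978 * (2 * t) ^ 2 ≤ 1.05 * (2 * t - 2) ^ 2 := by nlinarith
    have h3 : 0.05 * (2 * t * x) ≤ 4 * t - 2 := by nlinarith
    nlinarith [mul_le_mul_of_nonneg_left h2 h0, mul_le_mul_of_nonneg_left h3 h1]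

/-- Squaring removes the root, so the constructions only have to verify a polynomial inequality in
`q`. -/
theorem mul_ehlichBound_lt {k : ℕ} (hk : 3 ≤ k) {c W : ℝ} (hW : 0 ≤ W)
    (h : c ^ 2 * (4 * 11 ^ 6 / 7 ^ 7 * (2 * (k : ℝ) + 1)) * (2 * (k : ℝ)) ^ 6
      < (2 * (k : ℝ) - 2) ^ 4 * W ^ 2) :
    c * ehlichBound (2 * k + 1) < (2 * (k : ℝ) - 2) ^ (k - 1) * W := by
  have h3 : (3 : ℝ) ≤ k := by exact_mod_cast hk
  rw [ehlichBound_eq hk, pow_pred_mul_eq hk, ← mul_assoc]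
  refine mul_lt_mul_of_pos_right ?_ (pow_pos (by linarith) _)
  refine lt_of_pow_lt_pow_left₀ 2 (by positivity) ?_
  rw [mul_pow, mul_pow, Real.sq_sqrt (by positivity)]
  calc _ = c ^ 2 * (4 * 11 ^ 6 / 7 ^ 7 * (2 * (k : ℝ) + 1)) * (2 * (k : ℝ)) ^ 6 := by ring
    _ < _ := h
    _ = _ := by ring

/-- A sign matrix of odd order with large determinant in absolute value gives one with large
determinant. -/
theorem existsExceedingEhlich_of_abs_det {n : ℕ} (hn : Odd n) {ι : Type*} [Fintype ι]
    [DecidableEq ι] (hι : Fintype.card ι = n) (M : Matrix ι ι ℝ)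
    (hM : ∀ i j, M i j = 1 ∨ M i j = -1) {c : ℝ} (h : c * ehlichBound n < |M.det|) :
    ExistsExceedingEhlich n c := by
  have e : ι ≃ Fin n := Fintype.equivFinOfCardEq hι
  rcases abs_choice M.det with h' | h'
  · refine ⟨reindex e e M, fun i j => by simpa using hM _ _, ?_⟩
    rwa [det_reindex_self, ← h']
  · refine ⟨reindex e e (-M), fun i j => ?_, ?_⟩
    · rcases hM (e.symm i) (e.symm j) with h | h <;> simp [h]
    · rwa [det_reindex_self, det_neg, hι, hn.neg_one_pow, neg_one_mul, ← h']

theorem IsBorderPairOn.existsExceedingEhlich {ι : Type*} [Fintype ι] [DecidableEq ι]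
    {R S : Matrix ι ι ℝ} {r s : ℝ} (h : IsBorderPairOn R S r s)
    (hR : ∀ i j, R i j = 1 ∨ R i j = -1) (hS : ∀ i j, S i j = 1 ∨ S i j = -1)
    (hc : R * S = S * R) (hr : r ≤ 0) {n k : ℕ} (hk : 3 ≤ k) (hι : Fintype.card ι = k)
    (hn : n = 2 * k + 1) {c : ℝ}
    (hlt : c ^ 2 * (4 * 11 ^ 6 / 7 ^ 7 * (2 * (k : ℝ) + 1)) * (2 * (k : ℝ)) ^ 6
      < (2 * (k : ℝ) - 2) ^ 4 * (4 * k - 2 + 2 * k * |r|) ^ 2) :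
    ExistsExceedingEhlich n c := by
  subst hn
  have h3 : (3 : ℝ) ≤ k := by exact_mod_cast hk
  have hW : 0 ≤ 4 * (k : ℝ) - 2 + 2 * k * |r| :=
    add_nonneg (by linarith) (by positivity)
  refine existsExceedingEhlich_of_abs_det ⟨k, rfl⟩ (ι := (ι ⊕ ι) ⊕ Unit) ?_ _ ?_
    (lt_of_lt_of_eq (mul_ehlichBound_lt hk hW hlt)
      ((hι ▸ h.abs_det_border₂ (by omega) hr hc).symm))
  · simp [hι]; ring
  · have hneg : ∀ x : ℝ, x = 1 ∨ x = -1 → -x = 1 ∨ -x = -1 := by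
      rintro x (rfl | rfl) <;> simp
    rintro ((i | i) | i) ((j | j) | j)
    · exact hR _ _
    · exact hS _ _
    · exact Or.inl rfl
    · exact hS _ _
    · exact hneg _ (hR _ _)
    · exact Or.inr rfl
    all_goals exact Or.inl rfl

/-! ### Sign pairs from planar difference sets. -/

/-- A family of elements of a commutative group whose pairwise products are distinct. -/
def IsSidonFamily {ι G : Type*} [CommGroup G] (δ : ι → G) : Prop :=
  ∀ a b c d, δ a * δ b = δ c * δ d → (a = c ∧ b = d) ∨ (a = d ∧ b = c)

namespace IsSidonFamily

variable {ι G : Type*} [CommGroup G] {δ : ι → G}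

theorem sq (h : IsSidonFamily δ) (hG : Function.Injective fun g : G => g ^ 2) :
    IsSidonFamily fun i => δ i ^ 2 := fun a b c d he =>
  h a b c d (hG (by simpa [mul_pow] using he))

theorem div_injOn (h : IsSidonFamily δ) :
    Set.InjOn (fun p : ι × ι => δ p.1 / δ p.2) {p | p.1 ≠ p.2} := by
  rintro ⟨a, b⟩ hab ⟨c, d⟩ hcd he
  simp only [div_eq_div_iff_mul_eq_mul] at he
  rcases h a d c b he with ⟨rfl, rfl⟩ | ⟨h1, h2⟩
  · rfl
  · exact absurd h1 hab

theorem div_ne_one (h : IsSidonFamily δ) {a b : ι} (hab : a ≠ b) : δ a / δ b ≠ 1 := by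
  intro he
  rw [div_eq_one] at he
  rcases h a b b b (by rw [he]) with ⟨h1, -⟩ | ⟨h1, -⟩ <;> exact hab h1

end IsSidonFamily

/-- The permutation matrix of the translation by `g`. -/
def translationMatrix {G : Type*} [Group G] [DecidableEq G] (g : G) : Matrix G G ℝ :=
  Matrix.of fun x y => if x * g = y then 1 else 0

section translationMatrix

variable {G : Type*} [CommGroup G] [Fintype G] [DecidableEq G]

omit [Fintype G] in
theorem translationMatrix_one : translationMatrix (1 : G) = 1 := by
  ext x y; simp [translationMatrix, Matrix.one_apply]

theorem translationMatrix_mul (g h : G) :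
    translationMatrix g * translationMatrix h = translationMatrix (g * h) := by
  ext x y
  simp only [translationMatrix, Matrix.mul_apply, of_apply]
  rw [Finset.sum_eq_single (x * g)] <;> simp +contextual [mul_assoc, eq_comm]

omit [Fintype G] in
theorem translationMatrix_transpose (g : G) :
    (translationMatrix g)ᵀ = translationMatrix g⁻¹ := by
  ext x y
  simp only [translationMatrix, transpose_apply, of_apply, mul_inv_eq_iff_eq_mul]
  simp only [eq_comm]

theorem sum_translationMatrix : ∑ g : G, translationMatrix g = Matrix.of fun _ _ => 1 := by
  ext x y
  simp [translationMatrix, Matrix.sum_apply, ← eq_inv_mul_iff_mul_eq]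

theorem sum_translationMatrix_row (g x : G) : ∑ y, translationMatrix g x y = 1 := by
  simp [translationMatrix]

theorem sum_translationMatrix_col (g y : G) : ∑ x, translationMatrix g x y = 1 := by
  simp [translationMatrix, ← eq_mul_inv_iff_mul_eq]

variable {ι : Type*} [Fintype ι] [DecidableEq ι] {δ : ι → G}

omit [DecidableEq ι] in
theorem sum_translationMatrix_mul_ones (δ : ι → G) :
    (∑ i, translationMatrix (δ i)) * (Matrix.of fun _ _ => 1)
      = (Fintype.card ι : ℝ) • Matrix.of fun _ _ => 1 := by
  ext x y
  simp only [Matrix.mul_apply, Matrix.sum_apply, of_apply, mul_one]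
  rw [Finset.sum_comm]
  simp [sum_translationMatrix_row]

omit [DecidableEq ι] in
theorem ones_mul_sum_translationMatrix (δ : ι → G) :
    (Matrix.of fun _ _ => 1) * (∑ i, translationMatrix (δ i))
      = (Fintype.card ι : ℝ) • Matrix.of fun _ _ => 1 := by
  ext x y
  simp only [Matrix.mul_apply, Matrix.sum_apply, of_apply, one_mul]
  rw [Finset.sum_comm]
  simp [sum_translationMatrix_col]

/-- The `(q+1)q` quotients of distinct members are distinct and different from `1`, and `|G| - 1 =
q² + q`, so each non-identity element occurs exactly once: the family is a planar difference set. -/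
theorem sum_translationMatrix_mul_transpose {q : ℕ} (hι : Fintype.card ι = q + 1)
    (hG : Fintype.card G = q ^ 2 + q + 1) (h : IsSidonFamily δ) :
    (∑ i, translationMatrix (δ i)) * (∑ i, translationMatrix (δ i))ᵀ
      = (q : ℝ) • (1 : Matrix G G ℝ) + Matrix.of fun _ _ => 1 := by
  have himage : (Finset.univ.filter fun p : ι × ι => p.1 ≠ p.2).image
      (fun p => δ p.1 / δ p.2) = Finset.univ.erase 1 := by
    apply Finset.eq_of_subset_of_card_le
    · intro g hg
      obtain ⟨p, hp, rfl⟩ := Finset.mem_image.1 hg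
      simpa using h.div_ne_one (Finset.mem_filter.1 hp).2
    · rw [Finset.card_image_of_injOn (h.div_injOn.mono (by simp)),
        Finset.card_erase_of_mem (Finset.mem_univ _), Finset.card_univ, hG]
      have : (Finset.univ.filter fun p : ι × ι => p.1 ≠ p.2) = Finset.univ.offDiag := by
        ext p; simp
      rw [this, Finset.offDiag_card, Finset.card_univ, hι]
      rw [Nat.add_sub_cancel, Nat.le_sub_iff_add_le (by nlinarith)]
      nlinarith
  have hoff : ∑ p : ι × ι with p.1 ≠ p.2, translationMatrix (δ p.1 / δ p.2)
      = (Matrix.of fun _ _ => 1) - 1 := by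
    rw [← Finset.sum_image (f := fun g : G => translationMatrix g)
      (h.div_injOn.mono (by simp)), himage, ← sum_translationMatrix,
      ← Finset.add_sum_erase _ _ (Finset.mem_univ (1 : G)), translationMatrix_one]
    simp
  have hdiag : ∑ p : ι × ι with ¬ p.1 ≠ p.2, translationMatrix (δ p.1 / δ p.2)
      = ((q : ℝ) + 1) • (1 : Matrix G G ℝ) := by
    rw [Finset.sum_congr rfl (g := fun _ => (1 : Matrix G G ℝ))]
    · have : (Finset.univ.filter fun p : ι × ι => ¬ p.1 ≠ p.2) = Finset.univ.diag := by
        ext p; simp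
      rw [this, Finset.sum_const, Finset.diag_card, Finset.card_univ, hι,
        ← Nat.cast_smul_eq_nsmul ℝ]
      push_cast; rfl
    · intro p hp
      have : p.1 = p.2 := by simpa using hp
      rw [this, div_self', translationMatrix_one]
  rw [transpose_sum, Finset.sum_mul_sum, ← Finset.sum_product']
  simp only [translationMatrix_transpose, translationMatrix_mul, ← div_eq_mul_inv]
  rw [Finset.univ_product_univ, ← Finset.sum_filter_add_sum_filter_not _ (fun p => p.1 ≠ p.2),
    hoff, hdiag, add_smul, one_smul]
  abel

/-- A group element is not a product of two members, or is the square of a single member, or arises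
from one unordered pair of distinct members, which is counted twice. Thus `A² - J` vanishes exactly
where `C` is `1`. -/
theorem IsSidonFamily.sums_apply (h : IsSidonFamily δ) (x y : G) :
    let c := (∑ i, translationMatrix (δ i ^ 2)) x y
    let f := ((∑ i, translationMatrix (δ i)) * (∑ i, translationMatrix (δ i))) x y
    (c = 0 ∧ f = 0) ∨ (c = 1 ∧ f = 1) ∨ (c = 0 ∧ f = 2) := by
  intro c f
  have hc : c = ∑ i, if x * (δ i * δ i) = y then 1 else 0 := by
    simp [c, Matrix.sum_apply, translationMatrix, pow_two]
  have hf : f = ∑ i, ∑ j, if x * (δ i * δ j) = y then 1 else 0 := by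
    simp only [f, Finset.sum_mul_sum, translationMatrix_mul]
    simp [Matrix.sum_apply, translationMatrix]
  have hdiv : ∀ a b, x * (δ a * δ b) = y ↔ δ a * δ b = x⁻¹ * y := fun a b =>
    eq_inv_mul_iff_mul_eq.symm
  simp only [hdiv] at hc hf
  generalize x⁻¹ * y = g at hc hf
  by_cases hg : ∃ i j, δ i * δ j = g
  · obtain ⟨i, j, rfl⟩ := hg
    have hiff : ∀ a b, δ a * δ b = δ i * δ j ↔ (a = i ∧ b = j) ∨ (a = j ∧ b = i) := by
      refine fun a b => ⟨h a b i j, ?_⟩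
      rintro (⟨rfl, rfl⟩ | ⟨rfl, rfl⟩)
      · rfl
      · exact mul_comm _ _
    simp only [hiff] at hc hf
    by_cases hij : i = j
    · subst hij
      right; left
      simp only [or_self, and_self] at hc hf
      simp [hc, hf, ite_and]
    · right; right
      have hsplit : ∀ a b, (if (a = i ∧ b = j) ∨ (a = j ∧ b = i) then (1 : ℝ) else 0)
          = (if a = i then if b = j then 1 else 0 else 0)
            + (if a = j then if b = i then 1 else 0 else 0) := by
        intro a b
        by_cases h1 : a = i
        · subst h1; simp [hij]
        · simp [h1, ite_and]
      simp only [hsplit, Finset.sum_add_distrib] at hc hf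
      refine ⟨?_, ?_⟩
      · rw [hc]; simp [hij, Ne.symm hij]
      · rw [hf]; simp; norm_num
  · push Not at hg
    left
    simp [hc, hf, hg]

/-- A Sidon family of `q + 1` elements in a commutative group of odd order `q² + q + 1` gives a
pair of commuting sign matrices. -/
theorem IsSidonFamily.exists_isBorderPairOn {q : ℕ} (hι : Fintype.card ι = q + 1)
    (hG : Fintype.card G = q ^ 2 + q + 1) (h : IsSidonFamily δ) :
    ∃ R S : Matrix G G ℝ, IsBorderPairOn R S (-(2 * q + 1)) (-1) ∧ R * S = S * R ∧
      (∀ i j, R i j = 1 ∨ R i j = -1) ∧ (∀ i j, S i j = 1 ∨ S i j = -1) := by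
  have hsq : Function.Injective fun g : G => g ^ 2 := by
    have hco : (Nat.card G).Coprime 2 := by
      rw [Nat.coprime_two_right, Nat.card_eq_fintype_card, hG]
      have := Nat.even_mul_succ_self q
      rw [show q ^ 2 + q = q * (q + 1) by ring]
      exact this.add_one
    exact (powCoprime hco).injective
  have hA := sum_translationMatrix_mul_transpose hι hG h
  have hC := sum_translationMatrix_mul_transpose hι hG (h.sq hsq)
  have hAJ := sum_translationMatrix_mul_ones δ
  have hJA := ones_mul_sum_translationMatrix δ
  have hCJ := sum_translationMatrix_mul_ones fun i => δ i ^ 2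
  have hJC := ones_mul_sum_translationMatrix fun i => δ i ^ 2
  have hval := h.sums_apply
  have hAC : (∑ i, translationMatrix (δ i)) * (∑ i, translationMatrix (δ i ^ 2))
      = (∑ i, translationMatrix (δ i ^ 2)) * ∑ i, translationMatrix (δ i) := by
    rw [Finset.sum_mul_sum, Finset.sum_mul_sum, Finset.sum_comm]
    simp only [translationMatrix_mul, mul_comm]
  generalize (∑ i, translationMatrix (δ i)) = A at *
  generalize (∑ i, translationMatrix (δ i ^ 2)) = C at *
  have hJJ : (Matrix.of fun _ _ => 1 : Matrix G G ℝ) * (Matrix.of fun _ _ => 1)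
      = ((q : ℝ) ^ 2 + q + 1) • Matrix.of fun _ _ => 1 := by
    ext i j; simp [Matrix.mul_apply, hG]
  have hJT : (Matrix.of fun _ _ => 1 : Matrix G G ℝ)ᵀ = Matrix.of fun _ _ => 1 := rfl
  have hJAT : (Matrix.of fun _ _ => 1 : Matrix G G ℝ) * Aᵀ
      = (Fintype.card ι : ℝ) • Matrix.of fun _ _ => 1 := by
    rw [← hJT, ← transpose_mul, hAJ]; rfl
  have rowsum : ∀ (M : Matrix G G ℝ) (a : ℝ), M * (Matrix.of fun _ _ => 1)
      = a • (Matrix.of fun _ _ => 1) → ∀ i, ∑ j, M i j = a := fun M a hM i => by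
    simpa [Matrix.mul_apply] using congrFun₂ hM i i
  have colsum : ∀ (M : Matrix G G ℝ) (a : ℝ), (Matrix.of fun _ _ => 1) * M
      = a • (Matrix.of fun _ _ => 1) → ∀ i, ∑ j, M j i = a := fun M a hM i => by
    simpa [Matrix.mul_apply] using congrFun₂ hM i i
  have hgram : ∀ i j, ((Matrix.of fun _ _ => 1) : Matrix G G ℝ) i j = 1 := fun _ _ => rfl
  rw [hι] at hAJ hJA hCJ hJC hJAT
  push_cast at hAJ hJA hCJ hJC hJAT
  generalize hJ : (Matrix.of fun _ _ => 1 : Matrix G G ℝ) = J at *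
  have hAAJ : A * A * J = ((q : ℝ) + 1) ^ 2 • J := by
    rw [Matrix.mul_assoc, hAJ, Matrix.mul_smul, hAJ, smul_smul, pow_two]
  have hJAA : J * (A * A) = ((q : ℝ) + 1) ^ 2 • J := by
    rw [← Matrix.mul_assoc, hJA, Matrix.smul_mul, hJA, smul_smul, pow_two]
  have hJAAT : J * (A * A)ᵀ = ((q : ℝ) + 1) ^ 2 • J := by
    rw [transpose_mul, ← Matrix.mul_assoc, hJAT, Matrix.smul_mul, hJAT, smul_smul, pow_two]
  -- `A²(A²)ᵀ = A(qI + J)Aᵀ = q²I + (q + (q+1)²)J`, and the multiples of `J` cancel because `q +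
  -- (q+1)² - 2(q+1)² + (q²+q+1) = 0`.
  have hXX : (A * A - J) * (A * A - J)ᵀ
      = ((q : ℝ) ^ 2) • (1 : Matrix G G ℝ) := by
    have e : A * A * (A * A)ᵀ = A * (A * Aᵀ) * Aᵀ := by
      rw [transpose_mul]; simp only [Matrix.mul_assoc]
    rw [transpose_sub, hJT, Matrix.sub_mul, Matrix.mul_sub, Matrix.mul_sub, hAAJ, hJAAT, hJJ, e, hA,
      Matrix.mul_add, Matrix.add_mul, hAJ]
    simp only [Matrix.mul_smul, Matrix.smul_mul, Matrix.mul_one, hA, hJAT]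
    module
  refine ⟨-(C + (A * A - J)), -(C - (A * A - J)), ⟨?_, ?_, ?_, ?_, ?_⟩, ?_, ?_, ?_⟩
  · refine rowsum _ _ ?_
    simp only [Matrix.neg_mul, Matrix.add_mul, Matrix.sub_mul, hCJ, hAAJ, hJJ]
    module
  · refine colsum _ _ ?_
    simp only [Matrix.mul_neg, Matrix.mul_add, Matrix.mul_sub, hJC, hJAA, hJJ]
    module
  · refine rowsum _ _ ?_
    simp only [Matrix.neg_mul, Matrix.sub_mul, hCJ, hAAJ, hJJ]
    module
  · refine colsum _ _ ?_
    simp only [Matrix.mul_neg, Matrix.mul_sub, hJC, hJAA, hJJ]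
    module
  · have e : ∀ X : Matrix G G ℝ, -(C + X) * (-(C + X))ᵀ + -(C - X) * (-(C - X))ᵀ
        = (2 : ℝ) • (C * Cᵀ) + (2 : ℝ) • (X * Xᵀ) := fun X => by
      simp only [transpose_neg, transpose_add, transpose_sub, Matrix.neg_mul, Matrix.mul_neg,
        Matrix.add_mul, Matrix.sub_mul, Matrix.mul_add, Matrix.mul_sub]
      module
    rw [e, hXX, hC, hG, hJ]
    push_cast
    module
  · have h1 : C * (A * A - J) = (A * A - J) * C := by
      rw [Matrix.mul_sub, Matrix.sub_mul, hCJ, hJC, ← Matrix.mul_assoc, ← hAC, Matrix.mul_assoc,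
        ← hAC, Matrix.mul_assoc]
    have h2 : Commute C (A * A - J) := h1
    exact ((((Commute.refl C).sub_right h2).add_left
      (h2.symm.sub_right (Commute.refl _))).neg_left.neg_right).eq
  · intro i j
    simp only [Matrix.neg_apply, Matrix.add_apply, Matrix.sub_apply, hgram]
    rcases hval i j with ⟨h1, h2⟩ | ⟨h1, h2⟩ | ⟨h1, h2⟩ <;> rw [h1, h2] <;> norm_num
  · intro i j
    simp only [Matrix.neg_apply, Matrix.sub_apply, hgram]
    rcases hval i j with ⟨h1, h2⟩ | ⟨h1, h2⟩ | ⟨h1, h2⟩ <;> rw [h1, h2] <;> norm_num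

end translationMatrix

/-! ### Singer difference sets from cubic field extensions. -/

/-- The coefficients of the product of the polynomials indexed by two elements of `Option K`, where
`none` stands for `1` and `some a` for `X + a`. -/
def mulLinearCoeff {K : Type*} [Field K] : Option K → Option K → K × K × K
  | none, none => (1, 0, 0)
  | none, some a => (a, 1, 0)
  | some a, none => (a, 1, 0)
  | some a, some b => (a * b, a + b, 1)

/-- Unique factorization: proportional products have the same degree, hence equally many factors
`1`. Being monic they are then equal, and sum and product determine an unordered pair. -/
theorem eq_or_eq_of_mulLinearCoeff {K : Type*} [Field K] {a b c d : Option K} {w : K} (hw : w ≠ 0)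
    (h1 : (mulLinearCoeff a b).1 * w = (mulLinearCoeff c d).1)
    (h2 : (mulLinearCoeff a b).2.1 * w = (mulLinearCoeff c d).2.1)
    (h3 : (mulLinearCoeff a b).2.2 * w = (mulLinearCoeff c d).2.2) :
    (a = c ∧ b = d) ∨ (a = d ∧ b = c) := by
  rcases a with _ | a <;> rcases b with _ | b <;> rcases c with _ | c <;> rcases d with _ | d <;>
    simp only [mulLinearCoeff, one_mul, zero_mul] at h1 h2 h3 <;>
    first
    | exact absurd h3 hw
    | exact absurd h2 hw
    | exact absurd h3 zero_ne_one
    | exact absurd h2 zero_ne_one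
    | skip
  · simp
  · subst h2; simpa using h1
  · subst h2; simpa using h1
  · subst h2; simpa using h1
  · subst h2; simpa using h1
  · subst h3
    simp only [mul_one] at h1 h2
    simp only [Option.some.injEq]
    have : (a - c) * (a - d) = 0 := by linear_combination a * h2 - h1
    rcases mul_eq_zero.1 this with h | h
    · left; exact ⟨sub_eq_zero.1 h, by linear_combination h2 - h⟩
    · right; exact ⟨sub_eq_zero.1 h, by linear_combination h2 - h⟩

/-- A difference set of Singer type, as a Sidon family in the quotient of the multiplicative groups
of a cubic extension of a field with `q` elements. -/
theorem exists_isSidonFamily {q : ℕ} (hq : IsPrimePow q) :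
    ∃ (ι G : Type) (_ : Fintype ι) (_ : CommGroup G) (_ : Fintype G) (δ : ι → G),
      Fintype.card ι = q + 1 ∧ Fintype.card G = q ^ 2 + q + 1 ∧ IsSidonFamily δ := by
  classical
  obtain ⟨p, n, hp, hn, rfl⟩ := (isPrimePow_nat_iff q).1 hq
  have : Fact p.Prime := ⟨hp⟩
  let K := GaloisField p n
  have hK : Nat.card K = p ^ n := GaloisField.card p n hn.ne'
  let L := FiniteField.Extension K p 3
  have hL : Nat.card L = (p ^ n) ^ 3 := by rw [← hK]; exact FiniteField.natCard_extension K p 3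
  generalize p ^ n = q at *
  let pb := Field.powerBasisOfFiniteOfSeparable K L
  have hdim : pb.dim = 3 := by rw [← pb.finrank]; exact FiniteField.finrank_extension K p 3
  let θ := pb.gen
  have hli : ∀ x y z : K, algebraMap K L x + algebraMap K L y * θ + algebraMap K L z * θ ^ 2 = 0 →
      x = 0 ∧ y = 0 ∧ z = 0 := by
    intro x y z h
    have hb := (Fintype.linearIndependent_iff.1
      (pb.basis.linearIndependent.comp _ (finCongr hdim.symm).injective)) ![x, y, z] (by
        simp [Fin.sum_univ_three, Algebra.smul_def]
        simpa [θ] using h)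
    exact ⟨hb 0, hb 1, hb 2⟩
  let H : Subgroup Lˣ := (Units.map (algebraMap K L : K →* L)).range
  -- Modulo `Kˣ` these are the `q+1` points of the projective line spanned by `1` and `θ`. Products
  -- of two are polynomials in `θ` of degree at most `2`, whose coefficients are determined by
  -- `hli`.
  let P : Option K → L := fun o => o.elim 1 fun a => θ + algebraMap K L a
  have hP : ∀ o, P o ≠ 0 := by
    rintro (_ | a) h
    · exact one_ne_zero h
    · exact one_ne_zero (hli a 1 0 (by simpa [P, add_comm] using h)).2.1
  have hqpos : 0 < q := hq.pos
  have hcardL : Nat.card Lˣ = q ^ 3 - 1 := by rw [Nat.card_units, hL]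
  have hcardH : Nat.card H = q - 1 := by
    rw [← hK, ← Nat.card_units]
    exact (Nat.card_congr (MonoidHom.ofInjective (f := Units.map (algebraMap K L : K →* L))
      (Units.map_injective (algebraMap K L).injective)).toEquiv).symm
  refine ⟨Option K, Lˣ ⧸ H, Fintype.ofFinite _, inferInstance, Fintype.ofFinite _,
    fun o => (Units.mk0 (P o) (hP o) : Lˣ ⧸ H), ?_, ?_, ?_⟩
  · rw [Fintype.card_eq_nat_card, Finite.card_option, hK]
  · rw [Fintype.card_eq_nat_card]
    have h1 := H.card_eq_card_quotient_mul_card_subgroup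
    rw [hcardL, hcardH] at h1
    have h2 : 0 < q - 1 := Nat.sub_pos_of_lt hq.one_lt
    apply Nat.eq_of_mul_eq_mul_right h2
    rw [← h1]
    zify [hq.one_lt.le, Nat.one_le_pow 3 q hqpos]
    ring
  · intro a b c d he
    rw [← QuotientGroup.mk_mul, ← QuotientGroup.mk_mul, QuotientGroup.eq] at he
    obtain ⟨u, hu⟩ := he
    have hu' : P a * P b * algebraMap K L u = P c * P d := by
      have := congrArg (Units.val) (eq_inv_mul_iff_mul_eq.1 hu)
      simpa using this
    have hu0 : (u : K) ≠ 0 := u.ne_zero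
    generalize (u : K) = w at hu' hu0
    have key : ∀ x y z x' y' z' : K, (algebraMap K L x + algebraMap K L y * θ
        + algebraMap K L z * θ ^ 2) * algebraMap K L w = algebraMap K L x' + algebraMap K L y' * θ
        + algebraMap K L z' * θ ^ 2 → x * w = x' ∧ y * w = y' ∧ z * w = z' := by
      intro x y z x' y' z' h
      have := hli (x * w - x') (y * w - y') (z * w - z') (by
        simp only [map_sub, map_mul]
        linear_combination h)
      simpa [sub_eq_zero] using this
    have hco : ∀ a b, P a * P b = algebraMap K L (mulLinearCoeff a b).1 + algebraMap K L (mulLinearCoeff a b).2.1 * θ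
        + algebraMap K L (mulLinearCoeff a b).2.2 * θ ^ 2 := by
      rintro (_ | a) (_ | b) <;> simp [P, mulLinearCoeff] <;> ring
    rw [hco, hco] at hu'
    obtain ⟨h1, h2, h3⟩ := key _ _ _ _ _ _ hu'
    exact eq_or_eq_of_mulLinearCoeff hu0 h1 h2 h3

/-! ### Quadratic character sums and the Paley conference matrix. -/

section quadratic

variable {F : Type*} [Field F] [Fintype F] [DecidableEq F]

/-- The affine substitution `z = -(w-u)t - u` turns the sum into `χ(-1)` times the Jacobi sum of `χ`
with `χ⁻¹ = χ`, which equals `-χ(-1)`. -/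
theorem sum_quadraticChar_mul_shift (hF : ringChar F ≠ 2) {u w : F} (h : u ≠ w) :
    ∑ z : F, quadraticChar F (z + u) * quadraticChar F (z + w) = -1 := by
  have hχ := quadraticChar_ne_one hF
  have hJ := jacobiSum_nontrivial_inv hχ
  rw [(quadraticChar_isQuadratic F).inv, jacobiSum] at hJ
  have hd : w - u ≠ 0 := sub_ne_zero.2 h.symm
  let e : F ≃ F := (Equiv.mulLeft₀ (-(w - u)) (neg_ne_zero.2 hd)).trans (Equiv.subRight u)
  rw [← Equiv.sum_comp e]
  have hterm : ∀ t, quadraticChar F (e t + u) * quadraticChar F (e t + w)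
      = quadraticChar F (-1) * (quadraticChar F t * quadraticChar F (1 - t)) := by
    intro t
    have h1 : e t + u = (-1) * (w - u) * t := by simp [e]
    have h2 : e t + w = (w - u) * (1 - t) := by simp [e]; ring
    rw [h1, h2]
    simp only [map_mul]
    have := quadraticChar_sq_one hd
    linear_combination quadraticChar F (-1) * quadraticChar F t * quadraticChar F (1 - t) * this
  simp only [hterm, ← Finset.mul_sum, hJ]
  have := quadraticChar_sq_one (F := F) (a := -1) (by simp)
  linear_combination -this

/-- The real quadratic character. -/
def realChar (x : F) : ℝ := quadraticChar F x

theorem realChar_zero : realChar (0 : F) = 0 := by simp [realChar]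

theorem realChar_mul (x y : F) : realChar (x * y) = realChar x * realChar y := by
  simp only [realChar, map_mul, Int.cast_mul]

theorem realChar_eq {x : F} (hx : x ≠ 0) : realChar x = 1 ∨ realChar x = -1 := by
  rcases quadraticChar_dichotomy hx with h | h <;> simp [realChar, h]

theorem realChar_sq {x : F} (hx : x ≠ 0) : realChar x * realChar x = 1 := by
  rcases realChar_eq hx with h | h <;> simp [h]

theorem realChar_sub_comm (x y : F) : realChar (x - y) = realChar (-1 : F) * realChar (y - x) := by
  rw [← realChar_mul]; congr 1; ring

theorem sum_realChar (hF : ringChar F ≠ 2) : ∑ x : F, realChar x = 0 := by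
  simp only [realChar]
  exact_mod_cast quadraticChar_sum_zero hF

theorem sum_realChar_add (hF : ringChar F ≠ 2) (u : F) : ∑ x : F, realChar (u + x) = 0 := by
  rw [← sum_realChar hF]; exact Equiv.sum_comp (Equiv.addLeft u) _

theorem sum_realChar_sub (hF : ringChar F ≠ 2) (u : F) : ∑ x : F, realChar (u - x) = 0 := by
  rw [← sum_realChar hF]; exact Equiv.sum_comp (Equiv.subLeft u) _

theorem sum_realChar_add_mul_add (hF : ringChar F ≠ 2) (u w : F) :
    ∑ x : F, realChar (u + x) * realChar (w + x)
      = if u = w then (Fintype.card F : ℝ) - 1 else -1 := by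
  split_ifs with h
  · subst h
    have : ∀ x, realChar (u + x) * realChar (u + x) = if x = -u then (0 : ℝ) else 1 := by
      intro x
      split_ifs with hx
      · simp [hx, realChar_zero]
      · exact realChar_sq fun h => hx (by linear_combination h)
    simp only [this]
    rw [← Finset.add_sum_erase _ _ (Finset.mem_univ (-u)), if_pos rfl,
      Finset.sum_congr rfl (g := fun _ => (1 : ℝ)) (fun x hx => by
        rw [if_neg (Finset.ne_of_mem_erase hx)])]
    simp [Finset.card_erase_of_mem, Nat.cast_sub Fintype.card_pos]
  · have := sum_quadraticChar_mul_shift hF h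
    simp only [realChar]
    rw [← Finset.sum_congr rfl fun x _ => by rw [add_comm x u, add_comm x w]] at this
    exact_mod_cast this

theorem sum_realChar_sub_mul_sub (hF : ringChar F ≠ 2) (u w : F) :
    ∑ x : F, realChar (u - x) * realChar (w - x)
      = if u = w then (Fintype.card F : ℝ) - 1 else -1 := by
  rw [← sum_realChar_add_mul_add hF]
  simpa [sub_eq_add_neg] using
    (Equiv.sum_comp (Equiv.neg F) fun x => realChar (u + x) * realChar (w + x))

/-- The Paley conference matrix, indexed by the projective line over `F`. -/
def paleyConference : Option F → Option F → ℝ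
  | none, none => 0
  | none, some _ => 1
  | some _, none => 1
  | some x, some y => realChar (x - y)

theorem paleyConference_self (a : Option F) : paleyConference a a = 0 := by
  cases a <;> simp [paleyConference, realChar_zero]

theorem paleyConference_eq {a b : Option F} (h : a ≠ b) :
    paleyConference a b = 1 ∨ paleyConference a b = -1 := by
  rcases a with _ | a <;> rcases b with _ | b
  · exact absurd rfl h
  · exact Or.inl rfl
  · exact Or.inl rfl
  · exact realChar_eq (sub_ne_zero.2 fun h' => h (by rw [h']))

theorem sum_paleyConference_mul (hF : ringChar F ≠ 2) (a b : Option F) :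
    ∑ c, paleyConference a c * paleyConference b c
      = if a = b then (Fintype.card F : ℝ) else 0 := by
  rw [Fintype.sum_option]
  rcases a with _ | a <;> rcases b with _ | b
  · simp [paleyConference]
  · simp [paleyConference, sum_realChar_sub hF]
  · simp [paleyConference, sum_realChar_sub hF]
  · simp only [paleyConference, sum_realChar_sub_mul_sub hF, Option.some.injEq]
    split_ifs <;> ring

/-! ### The derived and residual parts of a Hadamard design. -/

/-- The sign `±1` attached to a Boolean. -/
def boolSign (e : Bool) : ℝ := if e then 1 else -1

/-- The indicator function of `0`. -/
def zeroIndicator (x : F) : ℝ := if x = 0 then 1 else 0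

omit [Fintype F] in
theorem zeroIndicator_add_neg (u w : F) : zeroIndicator (w + -u) = if u = w then 1 else 0 := by
  simp [zeroIndicator, ← sub_eq_add_neg, sub_eq_zero, eq_comm]

/-- The derived part of a Hadamard design of order `2q + 1`. -/
def derivedEntry (u : F) (c : F) (e : Bool) : ℝ :=
  -(boolSign e * realChar (u + c)) + zeroIndicator (u + c)

/-- The residual part of a Hadamard design of order `2q + 1`. -/
def residualEntry : Option F → F → Bool → ℝ
  | none, _, e => -(realChar (-1 : F) * boolSign e)
  | some v, c, e => realChar (v + c) + realChar (-1 : F) * boolSign e * zeroIndicator (v + c)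

theorem boolSign_eq (e : Bool) : boolSign e = 1 ∨ boolSign e = -1 := by cases e <;> simp [boolSign]

theorem mul_sign_eq {x y : ℝ} (hx : x = 1 ∨ x = -1) (hy : y = 1 ∨ y = -1) :
    x * y = 1 ∨ x * y = -1 := by
  rcases hx with rfl | rfl <;> rcases hy with rfl | rfl <;> norm_num

theorem neg_sign_eq {x : ℝ} (hx : x = 1 ∨ x = -1) : -x = 1 ∨ -x = -1 := by
  rcases hx with rfl | rfl <;> norm_num

theorem realChar_neg_one_eq : realChar (-1 : F) = 1 ∨ realChar (-1 : F) = -1 :=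
  realChar_eq (neg_ne_zero.2 one_ne_zero)

theorem derivedEntry_eq (u c : F) (e : Bool) :
    derivedEntry u c e = 1 ∨ derivedEntry u c e = -1 := by
  by_cases h : u + c = 0
  · simp [derivedEntry, h, realChar_zero, zeroIndicator]
  · simp only [derivedEntry, zeroIndicator, h, if_false, add_zero]
    exact neg_sign_eq (mul_sign_eq (boolSign_eq e) (realChar_eq h))

theorem residualEntry_eq (i : Option F) (c : F) (e : Bool) :
    residualEntry i c e = 1 ∨ residualEntry i c e = -1 := by
  rcases i with _ | v
  · exact neg_sign_eq (mul_sign_eq realChar_neg_one_eq (boolSign_eq e))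
  · by_cases h : v + c = 0
    · simp only [residualEntry, zeroIndicator, h, realChar_zero, if_true, zero_add, mul_one]
      exact mul_sign_eq realChar_neg_one_eq (boolSign_eq e)
    · simp only [residualEntry, zeroIndicator, h, if_false, mul_zero, add_zero]
      exact realChar_eq h

theorem sum_zeroIndicator_mul (u : F) (f : F → ℝ) :
    ∑ c, zeroIndicator (u + c) * f c = f (-u) := by
  simp [zeroIndicator, add_eq_zero_iff_eq_neg']

theorem sum_zeroIndicator (u : F) : ∑ c : F, zeroIndicator (u + c) = 1 := by
  simpa using sum_zeroIndicator_mul u fun _ => 1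

theorem sum_derivedEntry (u : F) : ∑ c, ∑ e, derivedEntry u c e = 2 := by
  have : ∀ c : F, ∑ e, derivedEntry u c e = 2 * zeroIndicator (u + c) := by
    intro c; simp [derivedEntry, boolSign]; ring
  simp only [this, ← Finset.mul_sum, sum_zeroIndicator, mul_one]

theorem sum_derivedEntry_mul (hF : ringChar F ≠ 2) (u w : F) :
    ∑ c, ∑ e, derivedEntry u c e * derivedEntry w c e
      = if u = w then 2 * (Fintype.card F : ℝ) else -2 := by
  have : ∀ c : F, ∑ e, derivedEntry u c e * derivedEntry w c e
      = 2 * (realChar (u + c) * realChar (w + c))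
        + 2 * (zeroIndicator (u + c) * zeroIndicator (w + c)) := by
    intro c; simp [derivedEntry, boolSign]; ring
  simp only [this, Finset.sum_add_distrib, ← Finset.mul_sum, sum_realChar_add_mul_add hF,
    sum_zeroIndicator_mul, zeroIndicator_add_neg]
  split_ifs <;> ring

theorem sum_residualEntry (hF : ringChar F ≠ 2) (i : Option F) :
    ∑ c, ∑ e, residualEntry i c e = 0 := by
  rcases i with _ | v
  · simp [residualEntry, boolSign]
  · have : ∀ c : F, ∑ e, residualEntry (some v) c e = 2 * realChar (v + c) := by
      intro c; simp [residualEntry, boolSign]; ring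
    simp only [this, ← Finset.mul_sum, sum_realChar_add hF, mul_zero]

theorem sum_residualEntry_mul (hF : ringChar F ≠ 2) (i j : Option F) :
    ∑ c, ∑ e, residualEntry i c e * residualEntry j c e
      = if i = j then 2 * (Fintype.card F : ℝ) else -2 := by
  have hτ := realChar_sq (F := F) (neg_ne_zero.2 one_ne_zero)
  rcases i with _ | v <;> rcases j with _ | w
  · simp [residualEntry, boolSign, hτ]; ring
  · have : ∀ c : F, ∑ e, residualEntry none c e * residualEntry (some w) c e
        = (-2) * zeroIndicator (w + c) := by
      intro c; simp [residualEntry, boolSign]; linear_combination -2 * zeroIndicator (w + c) * hτ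
    simp only [this, ← Finset.mul_sum, sum_zeroIndicator]; simp
  · have : ∀ c : F, ∑ e, residualEntry (some v) c e * residualEntry none c e
        = (-2) * zeroIndicator (v + c) := by
      intro c; simp [residualEntry, boolSign]; linear_combination -2 * zeroIndicator (v + c) * hτ
    simp only [this, ← Finset.mul_sum, sum_zeroIndicator]; simp
  · have : ∀ c : F, ∑ e, residualEntry (some v) c e * residualEntry (some w) c e
        = 2 * (realChar (v + c) * realChar (w + c))
          + 2 * (zeroIndicator (v + c) * zeroIndicator (w + c)) := by
      intro c; simp [residualEntry, boolSign]
      linear_combination 2 * zeroIndicator (v + c) * zeroIndicator (w + c) * hτ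
    simp only [this, Finset.sum_add_distrib, ← Finset.mul_sum, sum_realChar_add_mul_add hF,
      sum_zeroIndicator_mul, zeroIndicator_add_neg, Option.some.injEq]
    split_ifs <;> ring

/-- The factor `χ(-1)` in `residualEntry` is chosen for this: the surviving terms are `χ(v-u)` and
`χ(-1)χ(u-v)`, which cancel for every odd `q`. -/
theorem sum_derivedEntry_mul_residualEntry (hF : ringChar F ≠ 2) (u : F) (i : Option F) :
    ∑ c, ∑ e, derivedEntry u c e * residualEntry i c e = 0 := by
  rcases i with _ | v
  · have : ∀ c : F, ∑ e, derivedEntry u c e * residualEntry none c e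
        = 2 * realChar (-1 : F) * realChar (u + c) := by
      intro c; simp [derivedEntry, residualEntry, boolSign]; ring
    simp only [this, ← Finset.mul_sum, sum_realChar_add hF, mul_zero]
  · have : ∀ c : F, ∑ e, derivedEntry u c e * residualEntry (some v) c e
        = 2 * (zeroIndicator (u + c) * realChar (v + c))
          - 2 * realChar (-1 : F) * (zeroIndicator (v + c) * realChar (u + c)) := by
      intro c; simp [derivedEntry, residualEntry, boolSign]; ring
    simp only [this, Finset.sum_sub_distrib, ← Finset.mul_sum, sum_zeroIndicator_mul,
      ← sub_eq_add_neg]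
    rw [realChar_sub_comm v u]; ring

/-! ### Brouwer's symmetric design. -/

/-- The linear functionals on the plane `F × F`, one for every parallel class of lines. -/
def parallelClass : Option F → F × F → F
  | none, x => x.1
  | some m, x => x.2 + m * x.1

theorem sum_parallelClass {x y : F × F} (h : x ≠ y) :
    ∑ b, (if parallelClass b x = parallelClass b y then (1 : ℝ) else 0) = 1 := by
  rw [Fintype.sum_option]
  by_cases h1 : x.1 = y.1
  · have h2 : x.2 ≠ y.2 := fun h2 => h (Prod.ext h1 h2)
    simp [parallelClass, h1, h2]
  · have h2 : ∀ m : F, x.2 + m * x.1 = y.2 + m * y.1 ↔ m = (y.2 - x.2) / (x.1 - y.1) := by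
      intro m
      rw [eq_div_iff (sub_ne_zero.2 h1)]
      constructor <;> intro h <;> linear_combination h
    simp [parallelClass, h1, h2]

/-- Brouwer's symmetric design on `2q² + 2q + 1` points, as a sign matrix. -/
def brouwerMatrix (F : Type*) [Field F] [Fintype F] [DecidableEq F] :
    Matrix ((F × F) ⊕ (Option F × Option F)) (Unit ⊕ (Option F × F × Bool)) ℝ :=
  Matrix.of fun
    | Sum.inl _, Sum.inl _ => -1
    | Sum.inl x, Sum.inr (b, c, e) => derivedEntry (parallelClass b x) c e
    | Sum.inr _, Sum.inl _ => 1
    | Sum.inr (a, i), Sum.inr (b, c, e) =>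
      (if a = b then 1 else 0) + paleyConference a b * residualEntry i c e

theorem brouwerMatrix_eq (x y) : brouwerMatrix F x y = 1 ∨ brouwerMatrix F x y = -1 := by
  rcases x with x | ⟨a, i⟩ <;> rcases y with y | ⟨b, c, e⟩
  · exact Or.inr rfl
  · exact derivedEntry_eq _ _ _
  · exact Or.inl rfl
  · simp only [brouwerMatrix, of_apply]
    by_cases h : a = b
    · subst h; simp [paleyConference_self]
    · simp only [h, if_false, zero_add]
      exact mul_sign_eq (paleyConference_eq h) (residualEntry_eq _ _ _)

theorem sum_brouwerMatrix (hF : ringChar F ≠ 2) (x) :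
    ∑ y, brouwerMatrix F x y = 2 * (Fintype.card F : ℝ) + 1 := by
  rw [Fintype.sum_sum_type]
  simp only [Fintype.sum_prod_type]
  rcases x with x | ⟨a, i⟩
  · simp only [brouwerMatrix, of_apply, sum_derivedEntry]; simp; ring
  · simp only [brouwerMatrix, of_apply, Finset.sum_add_distrib, ← Finset.mul_sum,
      sum_residualEntry hF]
    simp; ring

/-- Two distinct points of the plane share a line in exactly one of the `q+1` parallel classes, so
their derived rows contribute `2q - 2q = 0`. Plane rows meet the others only through the all-ones
block `a = b`, giving `2 - 1`. Between rows `(a, i)` and `(b, j)` the conference matrix kills `a ≠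
b`; for `a = b` and `i ≠ j` the all-ones block gives `2q` and the residual rows give `q · (-2)`. -/
theorem brouwerMatrix_gram (hF : ringChar F ≠ 2) :
    brouwerMatrix F * (brouwerMatrix F)ᵀ
      = (2 * (Fintype.card F : ℝ) ^ 2 + 2 * Fintype.card F) • (1 : Matrix _ _ ℝ)
        + Matrix.of fun _ _ => 1 := by
  have cross : ∀ (x : F × F) (a i : Option F),
      ∑ b, ∑ c, ∑ e, derivedEntry (parallelClass b x) c e
        * ((if a = b then 1 else 0) + paleyConference a b * residualEntry i c e) = 2 := by
    intro x a i
    have h1 : ∀ b c e, derivedEntry (parallelClass b x) c e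
        * ((if a = b then 1 else 0) + paleyConference a b * residualEntry i c e)
        = (if a = b then 1 else 0) * derivedEntry (parallelClass b x) c e
          + paleyConference a b * (derivedEntry (parallelClass b x) c e * residualEntry i c e) := by
      intros; ring
    simp only [h1, Finset.sum_add_distrib, ← Finset.mul_sum, sum_derivedEntry,
      sum_derivedEntry_mul_residualEntry hF]
    simp
  ext x y
  simp only [Matrix.mul_apply, transpose_apply, Fintype.sum_sum_type, Fintype.sum_prod_type,
    Matrix.add_apply, Matrix.smul_apply, Matrix.one_apply, of_apply]
  rcases x with x | ⟨a, i⟩ <;> rcases y with y | ⟨b, j⟩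
  · simp only [brouwerMatrix, of_apply, sum_derivedEntry_mul hF]
    by_cases h : x = y
    · subst h; simp; ring
    · have hs := sum_parallelClass h
      have h1 : ∀ b, (if parallelClass b x = parallelClass b y then 2 * (Fintype.card F : ℝ)
          else -2) = (2 * (Fintype.card F : ℝ) + 2)
            * (if parallelClass b x = parallelClass b y then 1 else 0) - 2 := by
        intro b; split_ifs <;> ring
      simp only [h1, Finset.sum_sub_distrib, ← Finset.mul_sum, hs]
      simp [h]; ring
  · simp only [brouwerMatrix, of_apply, cross]
    simp; norm_num
  · simp only [brouwerMatrix, of_apply, mul_comm _ (derivedEntry _ _ _), cross]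
    simp; norm_num
  · have h1 : ∀ d c e, ((if a = d then 1 else 0) + paleyConference a d * residualEntry i c e)
        * ((if b = d then 1 else 0) + paleyConference b d * residualEntry j c e)
        = (if a = d then 1 else 0) * (if b = d then 1 else 0)
          + (if a = d then 1 else 0) * paleyConference b d * residualEntry j c e
          + (if b = d then 1 else 0) * paleyConference a d * residualEntry i c e
          + (paleyConference a d * paleyConference b d)
            * (residualEntry i c e * residualEntry j c e) := by
      intros; ring
    simp only [brouwerMatrix, of_apply, h1, Finset.sum_add_distrib, ← Finset.mul_sum,
      sum_residualEntry hF, sum_residualEntry_mul hF, ← Finset.sum_mul, sum_paleyConference_mul hF]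
    by_cases hab : a = b
    · subst hab
      by_cases hij : i = j
      · subst hij; simp; ring
      · simp [hij]
    · simp [hab]

end quadratic

/-- If the rows of a square matrix have constant sum `r ≠ 0` and its Gram matrix is `a I + b J`,
then its columns have sum `r` as well. -/
theorem colSum_eq_of_gram {ι : Type*} [Fintype ι] [DecidableEq ι] {B : Matrix ι ι ℝ} {a r : ℝ}
    (ha : a ≠ 0) (hr : r ≠ 0) (hrow : ∀ i, ∑ j, B i j = r)
    (hgram : B * Bᵀ = a • (1 : Matrix ι ι ℝ) + Matrix.of fun _ _ => 1)
    (har : a + Fintype.card ι = r ^ 2) (j : ι) : ∑ i, B i j = r := by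
  have : Nonempty ι := ⟨j⟩
  have hdet : IsUnit Bᵀ.det := by
    rw [isUnit_iff_ne_zero, det_transpose]
    intro h0
    have h1 := congrArg Matrix.det hgram
    rw [det_mul, h0, zero_mul, ← one_smul ℝ (Matrix.of fun _ _ => (1 : ℝ)),
      det_smul_one_add_smul_ones ha, mul_one, har] at h1
    exact mul_ne_zero (pow_ne_zero _ ha) (pow_ne_zero _ hr) h1.symm
  -- With `1` the all-ones row, `1BBᵀ = (a + |ι|)1 = r²1 = r1Bᵀ`, and `Bᵀ` is invertible.
  have h1 : ((fun _ => (1 : ℝ)) ᵥ* B - fun _ => r) ᵥ* Bᵀ = 0 := by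
    rw [sub_vecMul, vecMul_vecMul, hgram]
    ext i
    simp [vecMul, dotProduct, Matrix.one_apply, Finset.sum_add_distrib, ← Finset.mul_sum, hrow]
    linear_combination har
  have h2 := vecMul_injective_of_isUnit ((isUnit_iff_isUnit_det _).2 hdet)
    (h1.trans (zero_vecMul _).symm)
  have h3 := congrFun h2 j
  simpa [vecMul, dotProduct, sub_eq_zero] using h3

theorem exists_isBorderPairOn_of_odd {q : ℕ} (hq : IsPrimePow q) (hodd : Odd q) :
    ∃ (ι : Type) (_ : Fintype ι) (_ : DecidableEq ι) (R : Matrix ι ι ℝ),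
      Fintype.card ι = 2 * q ^ 2 + 2 * q + 1 ∧
      IsBorderPairOn R R (-(2 * q + 1)) (-(2 * q + 1)) ∧ ∀ i j, R i j = 1 ∨ R i j = -1 := by
  classical
  obtain ⟨p, n, hp, hn, rfl⟩ := (isPrimePow_nat_iff q).1 hq
  have : Fact p.Prime := ⟨hp⟩
  let F := GaloisField p n
  let _ : Fintype F := Fintype.ofFinite F
  have hK : Fintype.card F = p ^ n := by
    rw [Fintype.card_eq_nat_card]; exact GaloisField.card p n hn.ne'
  have hF : ringChar F ≠ 2 := by
    intro h2
    have := FiniteField.even_card_of_char_two h2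
    rw [hK] at this
    exact (Nat.not_even_iff_odd.2 hodd) (Nat.even_iff.2 this)
  have hB := brouwerMatrix_gram (F := F) hF
  have hs := sum_brouwerMatrix (F := F) hF
  have hv := brouwerMatrix_eq (F := F)
  rw [hK] at hB
  simp only [hK] at hs
  have hqpos : 0 < p ^ n := hq.pos
  have hc1 : Fintype.card ((F × F) ⊕ (Option F × Option F)) = 2 * (p ^ n) ^ 2 + 2 * p ^ n + 1 := by
    simp [hK]; ring
  have hc2 : Fintype.card (Unit ⊕ (Option F × F × Bool)) = 2 * (p ^ n) ^ 2 + 2 * p ^ n + 1 := by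
    simp [hK]; ring
  generalize p ^ n = q at *
  have hq0 : (0 : ℝ) < q := by exact_mod_cast hqpos
  -- Any bijection of columns with rows will do: Gram matrix and row sums are unaffected, and with
  -- `R = S` commutation is automatic.
  let e := Fintype.equivOfCardEq (hc1.trans hc2.symm)
  let B := (brouwerMatrix F).submatrix id e
  have hgram : B * Bᵀ = (2 * (q : ℝ) ^ 2 + 2 * q) • (1 : Matrix _ _ ℝ) + Matrix.of fun _ _ => 1 := by
    rw [← hB, transpose_submatrix, submatrix_mul_equiv]; rfl
  have hrow : ∀ i, ∑ j, B i j = 2 * q + 1 := fun i => by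
    rw [← hs i]; exact Equiv.sum_comp e fun j => brouwerMatrix F i j
  have hcol := colSum_eq_of_gram (by positivity) (by positivity) hrow hgram
    (by rw [hc1]; push_cast; ring)
  refine ⟨_, _, inferInstance, -B, hc1, ⟨?_, ?_, ?_, ?_, ?_⟩, fun i j => neg_sign_eq (hv i (e j))⟩
  · intro i; simp [hrow]
  · intro i; simp only [Matrix.neg_apply, Finset.sum_neg_distrib, hcol]
  · intro i; simp [hrow]
  · intro i; simp only [Matrix.neg_apply, Finset.sum_neg_distrib, hcol]
  · rw [transpose_neg, Matrix.neg_mul, Matrix.mul_neg, neg_neg, hgram, hc1]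
    push_cast
    module

/-! ### Numerical conclusions. -/

/-- Working from the exact determinant keeps the summand `4k-2`, which the estimate of part (1)
partly gives away; so the larger constant is reached already at the smaller threshold. -/
theorem existsExceedingEhlich_four {q : ℕ} (hq : IsPrimePow q) (hodd : Odd q) (h47 : 47 ≤ q) :
    ExistsExceedingEhlich (4 * q ^ 2 + 4 * q + 3) 0.34 := by
  obtain ⟨ι, _, _, R, hι, h, hR⟩ := exists_isBorderPairOn_of_odd hq hodd
  have h47' : (47 : ℝ) ≤ q := by exact_mod_cast h47
  refine h.existsExceedingEhlich hR hR rfl (by linarith) (by nlinarith) hι (by ring) ?_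
  rw [abs_neg, abs_of_nonneg (by positivity)]
  push_cast
  -- Expanded at the threshold, the difference of the two sides is a polynomial in `t` with positive
  -- coefficients only.
  obtain ⟨t, ht, hqt⟩ : ∃ t : ℝ, 0 ≤ t ∧ (q : ℝ) = t + 47 := ⟨q - 47, by linarith, by ring⟩
  rw [hqt, ← sub_pos]
  ring_nf
  positivity

theorem existsExceedingEhlich_two {q : ℕ} (hq : IsPrimePow q) (h43 : 43 ≤ q) :
    ExistsExceedingEhlich (2 * q ^ 2 + 2 * q + 3) 0.48 := by
  classical
  obtain ⟨ι, G, _, _, _, δ, hι, hG, hδ⟩ := exists_isSidonFamily hq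
  obtain ⟨R, S, h, hc, hR, hS⟩ := hδ.exists_isBorderPairOn hι hG
  have h43' : (43 : ℝ) ≤ q := by exact_mod_cast h43
  refine h.existsExceedingEhlich hR hS hc (by linarith) (by nlinarith) hG (by ring) ?_
  rw [abs_neg, abs_of_nonneg (by positivity)]
  push_cast
  obtain ⟨t, ht, hqt⟩ : ∃ t : ℝ, 0 ≤ t ∧ (q : ℝ) = t + 43 := ⟨q - 43, by linarith, by ring⟩
  rw [hqt, ← sub_pos]
  ring_nf
  positivity

theorem ExistsExceedingEhlich.mono {n : ℕ} {c d : ℝ} (h : ExistsExceedingEhlich n c) (hd : d ≤ c) :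
    ExistsExceedingEhlich n d := by
  obtain ⟨M, hM, hlt⟩ := h
  exact ⟨M, hM, (mul_le_mul_of_nonneg_right hd (Real.sqrt_nonneg _)).trans_lt hlt⟩

theorem mainTheorem1 :
    (∀ (k : ℕ) (R S : Matrix (Fin k) (Fin k) ℝ) (r s : ℝ),
      63 ≤ 2 * k + 1 → IsBorderPair R S r s → r ≤ 0 →
        (R * Sᵀ = S * Rᵀ →
          |r| / (3 * √((2 * k + 1 : ℕ) : ℝ)) * ehlichBound (2 * k + 1) ≤ |(borderedM₁ R S).det|) ∧
        (R * S = S * R →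
          |r| / (3 * √((2 * k + 1 : ℕ) : ℝ)) * ehlichBound (2 * k + 1) ≤ |(borderedM₂ R S).det|)) ∧
    (∀ q : ℕ, IsPrimePow q → Odd q →
      (379 ≤ q → ExistsExceedingEhlich (4 * q ^ 2 + 4 * q + 3) 0.34) ∧
      (47 ≤ q → ExistsExceedingEhlich (4 * q ^ 2 + 4 * q + 3) (1 / 3))) ∧
    (∀ q : ℕ, IsPrimePow q →
      (233 ≤ q → ExistsExceedingEhlich (2 * q ^ 2 + 2 * q + 3) 0.48) ∧
      (43 ≤ q → ExistsExceedingEhlich (2 * q ^ 2 + 2 * q + 3) 0.47)) := by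
  refine ⟨fun k R S r s hk hRS hr => ?_, fun q hq hodd => ⟨fun h => ?_, fun h => ?_⟩,
    fun q hq => ⟨fun h => ?_, fun h => ?_⟩⟩
  · have h := hRS.isBorderPairOn
    have : NeZero k := ⟨by omega⟩
    have hle := mul_ehlichBound_le (k := k) (by omega) (by simpa using h.sq_add_sq)
    have hk2 : 2 ≤ Fintype.card (Fin k) := by rw [Fintype.card_fin]; omega
    refine ⟨fun hc => hle.trans_eq ?_, fun hc => hle.trans_eq ?_⟩
    · simpa only [Fintype.card_fin, borderedM₁, border] using (h.abs_det_border₁ hk2 hr hc).symm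
    · simpa only [Fintype.card_fin, borderedM₂, border] using (h.abs_det_border₂ hk2 hr hc).symm
  · exact existsExceedingEhlich_four hq hodd (by omega)
  · exact (existsExceedingEhlich_four hq hodd h).mono (by norm_num)
  · exact existsExceedingEhlich_two hq (by omega)
  · exact (existsExceedingEhlich_two hq h).mono (by norm_num)
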